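/- Let $(M,g)$ be a smooth (not necessarily complete) semi-Riemannian manifold and let $\epsilon\in\{1,-1\}$. Let $\widehat M=\mathbb{R}_{>0}\times M$ be equipped with the cone metric $\widehat g=\epsilon\,dr^2+r^2g$, where $r$ is the coordinate on $\mathbb{R}_{>0}$, and write $\partial_r$ for the radial vector field. Let $V$ be a smooth vector field on $\widehat M$ that is parallel for the Levi-Civita connection $\widehat\nabla$ of $\widehat g$, i.e. $\widehat\nabla V=0$. Then the function $\widehat g(V,\partial_r)$ does not depend on $r$: there is a smooth function $u\in C^\infty(M)$ with $\widehat g(V,\partial_r)_{(r,p)}=u(p)$ for all $(r,p)\in\widehat M$. Moreover, at every $(r,p)\in\widehat M$, $$V=\epsilon\,u\,\partial_r+\frac1r\,\nabla u,$$ where $\nabla u$ is the gradient of $u$ with respect to $g$, regarded as a vector tangent to $\{r\}\times M$, and $u$ satisfies $$\nabla du=-\epsilon\,u\,g \quad\text{on } M,$$ where $\nabla$ is the Levi-Civita connection of $g$ and $(\nabla du)(X,Y)=X(du(Y))-du(\nabla_XY)$. -/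

import Mathlib

open Bundle
open scoped Manifold ContDiff

noncomputable section

section General

variable {E : Type*} [NormedAddCommGroup E] [NormedSpace ℝ E]
  {H : Type*} [TopologicalSpace H] (I : ModelWithCorners ℝ E H)
  (M : Type*) [TopologicalSpace M] [ChartedSpace H M]

/-- A smooth semi-Riemannian metric on `M`: a smooth family of symmetric nondegenerate bilinear
forms on the tangent spaces. -/
structure SemiRiemannianMetric [IsManifold I ∞ M] where
  inner (x : M) : TangentSpace I x →L[ℝ] TangentSpace I x →L[ℝ] ℝ
  symm (x : M) (v w : TangentSpace I x) : inner x v w = inner x w v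
  nondegenerate (x : M) (v : TangentSpace I x) (hv : ∀ w, inner x v w = 0) : v = 0
  contMDiff : ContMDiff I (I.prod 𝓘(ℝ, E →L[ℝ] E →L[ℝ] ℝ)) ∞
    (fun x ↦ TotalSpace.mk' (E →L[ℝ] E →L[ℝ] ℝ)
      (E := fun x : M ↦ TangentSpace I x →L[ℝ] TangentSpace I x →L[ℝ] ℝ) x (inner x))

variable {M} in
/-- Components of a tangent vector at `y` in the coordinate frame of the preferred chart at `x`. -/
def coordVec [IsManifold I ∞ M] (x y : M) : TangentSpace I y →L[ℝ] E :=
  (trivializationAt E (TangentSpace I) x).continuousLinearMapAt ℝ y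

variable {M} in
/-- The tangent vector at `y` with given components in the coordinate frame of the preferred chart
at `x`. -/
def ofCoordVec [IsManifold I ∞ M] (x y : M) : E →L[ℝ] TangentSpace I y :=
  (trivializationAt E (TangentSpace I) x).symmL ℝ y

variable {I M} in
/-- The components of a bilinear form on the tangent space at `y` in the coordinate frame of the
preferred chart at `x`. -/
def coordForm [IsManifold I ∞ M] (x : M) {y : M}
    (b : TangentSpace I y →L[ℝ] TangentSpace I y →L[ℝ] ℝ) : E →L[ℝ] E →L[ℝ] ℝ :=
  (ofCoordVec I x y).precomp ℝ ∘L b ∘L ofCoordVec I x y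

variable {I M} in
lemma inCoordinates_eq_coordForm [IsManifold I ∞ M] {x y : M}
    (hy : y ∈ (trivializationAt E (TangentSpace I) x).baseSet)
    (b : TangentSpace I y →L[ℝ] TangentSpace I y →L[ℝ] ℝ) :
    ContinuousLinearMap.inCoordinates E (TangentSpace I) (E →L[ℝ] ℝ)
      (fun y : M ↦ TangentSpace I y →L[ℝ] ℝ) x y x y b = coordForm x b := by
  have hy' : y ∈ (trivializationAt (E →L[ℝ] ℝ)
      (fun y : M ↦ TangentSpace I y →L[ℝ] ℝ) x).baseSet := by
    rw [hom_trivializationAt_baseSet]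
    exact ⟨hy, trivial⟩
  ext e e'
  rw [ContinuousLinearMap.inCoordinates, ContinuousLinearMap.comp_apply,
    ContinuousLinearMap.comp_apply, Trivialization.continuousLinearMapAt_apply,
    Trivialization.linearMapAt_apply, if_pos hy', hom_trivializationAt_apply,
    ContinuousLinearMap.inCoordinates]
  simp [coordForm, ofCoordVec]

variable {I M} in
lemma contMDiff_form_iff [IsManifold I ∞ M]
    (b : Π x : M, TangentSpace I x →L[ℝ] TangentSpace I x →L[ℝ] ℝ) (x : M) :
    ContMDiffAt I (I.prod 𝓘(ℝ, E →L[ℝ] E →L[ℝ] ℝ)) ∞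
      (fun x ↦ TotalSpace.mk' (E →L[ℝ] E →L[ℝ] ℝ)
        (E := fun x : M ↦ TangentSpace I x →L[ℝ] TangentSpace I x →L[ℝ] ℝ) x (b x)) x ↔
    ContMDiffAt I 𝓘(ℝ, E →L[ℝ] E →L[ℝ] ℝ) ∞ (fun y ↦ coordForm x (b y)) x := by
  rw [contMDiffAt_hom_bundle]
  have : (fun y ↦ ContinuousLinearMap.inCoordinates E (TangentSpace I) (E →L[ℝ] ℝ)
      (fun y : M ↦ TangentSpace I y →L[ℝ] ℝ) x y x y (b y)) =ᶠ[nhds x]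
      (fun y ↦ coordForm x (b y)) := by
    filter_upwards [(trivializationAt E (TangentSpace I) x).open_baseSet.mem_nhds
      (FiberBundle.mem_baseSet_trivializationAt' x)] with y hy
    exact inCoordinates_eq_coordForm hy (b y)
  constructor
  · exact fun h ↦ h.2.congr_of_eventuallyEq this.symm
  · exact fun h ↦ ⟨contMDiffAt_id, h.congr_of_eventuallyEq this⟩

section pullback
variable {I M} {E' : Type*} [NormedAddCommGroup E'] [NormedSpace ℝ E']
  {H' : Type*} [TopologicalSpace H'] {I' : ModelWithCorners ℝ E' H'}
  {N : Type*} [TopologicalSpace N] [ChartedSpace H' N]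

lemma contMDiff_pullback_form [IsManifold I ∞ M] [IsManifold I' ∞ N]
    (b : Π x : M, TangentSpace I x →L[ℝ] TangentSpace I x →L[ℝ] ℝ)
    (hb : ContMDiff I (I.prod 𝓘(ℝ, E →L[ℝ] E →L[ℝ] ℝ)) ∞
      (fun x ↦ TotalSpace.mk' (E →L[ℝ] E →L[ℝ] ℝ)
        (E := fun x : M ↦ TangentSpace I x →L[ℝ] TangentSpace I x →L[ℝ] ℝ) x (b x)))
    {f : N → M} (hf : ContMDiff I' I ∞ f) :
    ContMDiff I' (I'.prod 𝓘(ℝ, E' →L[ℝ] E' →L[ℝ] ℝ)) ∞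
      (fun q ↦ TotalSpace.mk' (E' →L[ℝ] E' →L[ℝ] ℝ)
        (E := fun q : N ↦ TangentSpace I' q →L[ℝ] TangentSpace I' q →L[ℝ] ℝ) q
        ((mfderiv I' I f q).precomp ℝ ∘L b (f q) ∘L mfderiv I' I f q)) := by
  intro q
  rw [contMDiff_form_iff]
  have h1 := ((contMDiff_form_iff b (f q)).1 (hb (f q))).comp q (hf q)
  have h2 := (hf q).mfderiv_const (m := ∞) (by simp)
  have h3 := (h2.clm_precomp (F₃ := ℝ)).clm_comp (h1.clm_comp h2)
  refine h3.congr_of_eventuallyEq ?_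
  filter_upwards [(trivializationAt E' (TangentSpace I') q).open_baseSet.mem_nhds
      (FiberBundle.mem_baseSet_trivializationAt' q),
      hf.continuous.continuousAt.preimage_mem_nhds
       ((trivializationAt E (TangentSpace I) (f q)).open_baseSet.mem_nhds
      (FiberBundle.mem_baseSet_trivializationAt' (f q)))] with p hp hp'
  ext e e'
  have key : ∀ e, ofCoordVec I (f q) (f p) (inTangentCoordinates I' I id f
      (fun p ↦ mfderiv I' I f p) q p e) = mfderiv I' I f p (ofCoordVec I' q p e) := by
    intro e
    exact (trivializationAt E (TangentSpace I) (f q)).symmL_continuousLinearMapAt hp' _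
  change b (f p) (mfderiv I' I f p (ofCoordVec I' q p e))
     (mfderiv I' I f p (ofCoordVec I' q p e')) = b (f p) (ofCoordVec I (f q) (f p) (inTangentCoordinates I' I id f
      (fun p ↦ mfderiv I' I f p) q p e)) (ofCoordVec I (f q) (f p) (inTangentCoordinates I' I id f
      (fun p ↦ mfderiv I' I f p) q p e'))
  rw [key, key]

end pullback

namespace SemiRiemannianMetric

variable {I M} [IsManifold I ∞ M] [FiniteDimensional ℝ E] (g : SemiRiemannianMetric I M)

instance tangentSpaceFiniteDimensional (x : M) : FiniteDimensional ℝ (TangentSpace I x) :=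
  inferInstanceAs (FiniteDimensional ℝ E)

instance tangentSpaceT2 (x : M) : T2Space (TangentSpace I x) :=
  inferInstanceAs (T2Space E)

/-- The isomorphism `v ↦ g(v, ·)` from tangent to cotangent vectors. -/
def flat (x : M) : TangentSpace I x ≃ₗ[ℝ] Module.Dual ℝ (TangentSpace I x) :=
  (ContinuousLinearMap.coeLM ℝ ∘ₗ (g.inner x).toLinearMap).linearEquivOfInjective
    ((injective_iff_map_eq_zero _).2 fun v hv ↦
      g.nondegenerate x v fun w ↦ LinearMap.congr_fun hv w)
    Subspace.dual_finrank_eq.symm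

lemma inner_flat_symm (x : M) (α : Module.Dual ℝ (TangentSpace I x)) (w : TangentSpace I x) :
    g.inner x ((g.flat x).symm α) w = α w :=
  LinearMap.congr_fun ((g.flat x).apply_symm_apply α) w

/-- The matrix `g_{ij}` at `y` of the metric, in the chart at `x`. -/
def coord (x y : M) : E →L[ℝ] E →L[ℝ] ℝ :=
  coordForm x (g.inner y)

/-- The coordinate derivative `∂_v g(w, z)` at `x` of the metric in the chart at `x`. -/
def dCoord (x : M) (v w z : TangentSpace I x) : ℝ :=
  mvfderiv I (g.coord x) x v (coordVec I x x w) (coordVec I x x z)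

lemma dCoord_add₁ (x : M) (v v' w z : TangentSpace I x) :
    g.dCoord x (v + v') w z = g.dCoord x v w z + g.dCoord x v' w z := by
  rw [dCoord, ContinuousLinearMap.map_add]
  rfl

lemma dCoord_add₂ (x : M) (v w w' z : TangentSpace I x) :
    g.dCoord x v (w + w') z = g.dCoord x v w z + g.dCoord x v w' z := by
  rw [dCoord, ContinuousLinearMap.map_add, ContinuousLinearMap.map_add]
  rfl

lemma dCoord_add₃ (x : M) (v w z z' : TangentSpace I x) :
    g.dCoord x v w (z + z') = g.dCoord x v w z + g.dCoord x v w z' := by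
  rw [dCoord, ContinuousLinearMap.map_add, ContinuousLinearMap.map_add]
  rfl

lemma dCoord_smul₁ (x : M) (c : ℝ) (v w z : TangentSpace I x) :
    g.dCoord x (c • v) w z = c * g.dCoord x v w z := by
  rw [dCoord, ContinuousLinearMap.map_smul]
  rfl

lemma dCoord_smul₂ (x : M) (c : ℝ) (v w z : TangentSpace I x) :
    g.dCoord x v (c • w) z = c * g.dCoord x v w z := by
  rw [dCoord, ContinuousLinearMap.map_smul, ContinuousLinearMap.map_smul]
  rfl

lemma dCoord_smul₃ (x : M) (c : ℝ) (v w z : TangentSpace I x) :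
    g.dCoord x v w (c • z) = c * g.dCoord x v w z := by
  rw [dCoord, ContinuousLinearMap.map_smul, ContinuousLinearMap.map_smul]
  rfl

/-- The Christoffel symbols of the first kind
`Γ(v, w; z) = (∂_v g(w, z) + ∂_w g(v, z) - ∂_z g(v, w)) / 2` in the chart at `x`. -/
def christoffelLower (x : M) (v w : TangentSpace I x) : Module.Dual ℝ (TangentSpace I x) where
  toFun z := (g.dCoord x v w z + g.dCoord x w v z - g.dCoord x z v w) / 2
  map_add' z z' := by simp only [dCoord_add₁, dCoord_add₃]; ring
  map_smul' c z := by
    simp only [dCoord_smul₁, dCoord_smul₃, RingHom.id_apply, smul_eq_mul]; ring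

/-- The Christoffel symbols of the second kind: `g(Γ(v, w), z) = Γ(v, w; z)`. -/
def christoffel (x : M) :
    TangentSpace I x →ₗ[ℝ] TangentSpace I x →ₗ[ℝ] TangentSpace I x :=
  LinearMap.mk₂ ℝ (fun v w ↦ (g.flat x).symm (g.christoffelLower x v w))
    (fun v v' w ↦ by
      rw [← map_add]
      congr 1
      ext z
      simp only [christoffelLower, LinearMap.coe_mk, AddHom.coe_mk, LinearMap.add_apply,
        dCoord_add₁, dCoord_add₂]
      ring)
    (fun c v w ↦ by
      rw [← map_smul]
      congr 1
      ext z
      simp only [christoffelLower, LinearMap.coe_mk, AddHom.coe_mk, LinearMap.smul_apply,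
        dCoord_smul₁, dCoord_smul₂, smul_eq_mul]
      ring)
    (fun v w w' ↦ by
      rw [← map_add]
      congr 1
      ext z
      simp only [christoffelLower, LinearMap.coe_mk, AddHom.coe_mk, LinearMap.add_apply,
        dCoord_add₁, dCoord_add₂, dCoord_add₃]
      ring)
    (fun c v w ↦ by
      rw [← map_smul]
      congr 1
      ext z
      simp only [christoffelLower, LinearMap.coe_mk, AddHom.coe_mk, LinearMap.smul_apply,
        dCoord_smul₁, dCoord_smul₂, dCoord_smul₃, smul_eq_mul]
      ring)

lemma mdifferentiableAt_coordVec {σ : Π x : M, TangentSpace I x} {x : M} (hσ : MDiffAt (T% σ) x) :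
    MDiffAt (fun y ↦ coordVec I x y (σ y)) x := by
  refine ((mdifferentiableAt_section I σ).1 hσ).congr_of_eventuallyEq ?_
  filter_upwards [(trivializationAt E (TangentSpace I) x).open_baseSet.mem_nhds
    (FiberBundle.mem_baseSet_trivializationAt' x)] with y hy
  rw [coordVec, Trivialization.continuousLinearMapAt_apply, Trivialization.linearMapAt_apply,
    if_pos hy]

lemma ofCoordVec_coordVec (x : M) (v : TangentSpace I x) :
    ofCoordVec I x x (coordVec I x x v) = v :=
  (trivializationAt E (TangentSpace I) x).symmL_continuousLinearMapAt
    (FiberBundle.mem_baseSet_trivializationAt' x) v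

/-- The Levi-Civita connection, `∇_v σ = ∂_v σ + Γ(v, σ)` in the chart at the given point; here
`g.leviCivita σ x v` is `(∇_v σ)(x)`. It is the metric connection without torsion, see
`leviCivita_metric` and `leviCivita_torsion`. -/
def leviCivita : CovariantDerivative I E (TangentSpace I : M → Type _) where
  toFun σ x := ofCoordVec I x x ∘L mvfderiv I (fun y ↦ coordVec I x y (σ y)) x
    + LinearMap.toContinuousLinearMap ((g.christoffel x).flip (σ x))
  isCovariantDerivativeOnUniv :=
    { add := by
        intro σ σ' x hσ hσ' _
        ext v
        have h := mvfderiv_add (mdifferentiableAt_coordVec hσ) (mdifferentiableAt_coordVec hσ')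
        have e : (fun y ↦ coordVec I x y ((σ + σ') y)) =
          (fun y ↦ coordVec I x y (σ y)) + (fun y ↦ coordVec I x y (σ' y)) := by
          ext y; simp
        rw [e, h]
        simp
        abel
      leibniz := by
        intro σ f x hσ hf _
        ext v
        have h := mvfderiv_smul hf (mdifferentiableAt_coordVec hσ)
        have e : (fun y ↦ coordVec I x y ((f • σ) y)) =
          f • (fun y ↦ coordVec I x y (σ y)) := by
          ext y; simp
        rw [e, h]
        simp [ofCoordVec_coordVec]
        module }

lemma mdifferentiableAt_coord (x : M) : MDiffAt (fun y ↦ g.coord x y) x :=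
  ((contMDiff_form_iff _ x).1 (g.contMDiff x)).mdifferentiableAt (by simp)

lemma coord_symm (x y : M) (a b : E) : g.coord x y a b = g.coord x y b a := g.symm _ _ _

lemma coord_coordVec {x y : M} (hy : y ∈ (trivializationAt E (TangentSpace I) x).baseSet)
    (v w : TangentSpace I y) : g.coord x y (coordVec I x y v) (coordVec I x y w) = g.inner y v w := by
  have h : ∀ v : TangentSpace I y, ofCoordVec I x y (coordVec I x y v) = v := fun v ↦
    (trivializationAt E (TangentSpace I) x).symmL_continuousLinearMapAt hy v
  change g.inner y (ofCoordVec I x y (coordVec I x y v)) (ofCoordVec I x y (coordVec I x y w)) = _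
  rw [h, h]

lemma dCoord_symm (x : M) (v w z : TangentSpace I x) : g.dCoord x v w z = g.dCoord x v z w := by
  have h : ∀ a b : E, mvfderiv I (g.coord x) x v a b = mvfderiv I (g.coord x) x v b a := by
    intro a b
    have hd : ∀ a b : E, mvfderiv I (fun y ↦ g.coord x y a b) x v =
        mvfderiv I (g.coord x) x v a b := by
      intro a b
      have h1 := (g.mdifferentiableAt_coord x).hasMFDerivAt
      have h4 : HasMFDerivAt I 𝓘(ℝ, ℝ) (fun y ↦ g.coord x y a b) x _ :=
        ⟨(h1.1.clm_apply continuousAt_const).clm_apply continuousAt_const,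
          (h1.2.clm_apply (hasFDerivWithinAt_const a _ _)).clm_apply
            (hasFDerivWithinAt_const b _ _)⟩
      refine (DFunLike.congr_fun h4.mfderiv v).trans ?_
      simp
      rfl
    rw [← hd, ← hd]
    simp only [g.coord_symm x _ a b]
  exact h _ _

lemma christoffel_symm (x : M) (v w : TangentSpace I x) :
    g.christoffel x v w = g.christoffel x w v := by
  simp only [christoffel, LinearMap.mk₂_apply]
  congr 1
  ext z
  simp only [christoffelLower, LinearMap.coe_mk, AddHom.coe_mk]
  rw [g.dCoord_symm x z v w]; ring

lemma inner_christoffel (x : M) (v w z : TangentSpace I x) : g.inner x (g.christoffel x v w) z =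
   (g.dCoord x v w z + g.dCoord x w v z - g.dCoord x z v w) / 2 := by
  simp only [christoffel, LinearMap.mk₂_apply, inner_flat_symm]
  rfl

/-- The connection `leviCivita` is compatible with the metric. -/
theorem leviCivita_metric {σ τ : Π x : M, TangentSpace I x} {x : M} (hσ : MDiffAt (T% σ) x)
    (hτ : MDiffAt (T% τ) x) (v : TangentSpace I x) :
    mvfderiv I (fun y ↦ g.inner y (σ y) (τ y)) x v =
      g.inner x (g.leviCivita σ x v) (τ x) + g.inner x (σ x) (g.leviCivita τ x v) := by
  have hx := FiberBundle.mem_baseSet_trivializationAt' (F := E) (E := (TangentSpace I : M → Type _)) x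
  have e : (fun y ↦ g.inner y (σ y) (τ y)) =ᶠ[nhds x]
     (fun y ↦ g.coord x y (coordVec I x y (σ y)) (coordVec I x y (τ y))) := by
    filter_upwards [(trivializationAt E (TangentSpace I) x).open_baseSet.mem_nhds hx] with y hy
    exact (g.coord_coordVec hy _ _).symm
  have h1 := (g.mdifferentiableAt_coord x).hasMFDerivAt
  have h2 := (mdifferentiableAt_coordVec hσ).hasMFDerivAt
  have h3 := (mdifferentiableAt_coordVec hτ).hasMFDerivAt
  have h4 : HasMFDerivAt I 𝓘(ℝ, ℝ)
     (fun y ↦ g.coord x y (coordVec I x y (σ y)) (coordVec I x y (τ y))) x _ :=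
    ⟨(h1.1.clm_apply h2.1).clm_apply h3.1, (h1.2.clm_apply h2.2).clm_apply h3.2⟩
  have h5 := DFunLike.congr_fun ((h4.congr_of_eventuallyEq e).mfderiv) v
  have h6 : ∀ (σ : Π x : M, TangentSpace I x), g.leviCivita σ x v =
     ofCoordVec I x x (mvfderiv I (fun y ↦ coordVec I x y (σ y)) x v) + g.christoffel x v (σ x) :=
    fun _ ↦ rfl
  rw [h6, h6]
  rw [map_add, map_add, _root_.add_apply, g.symm x (σ x) (g.christoffel _ _ _),
    inner_christoffel, inner_christoffel]
  have h7 : mvfderiv I (fun y ↦ g.inner y (σ y) (τ y)) x v =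
     g.dCoord x v (σ x) (τ x) + g.coord x x (mvfderiv I (fun y ↦ coordVec I x y (σ y)) x v)
       (coordVec I x x (τ x)) + g.coord x x (coordVec I x x (σ x))
         (mvfderiv I (fun y ↦ coordVec I x y (τ y)) x v) := by
    refine h5.trans ?_
    have hp := extChartAt_to_inv (I := I) x
    set p := (extChartAt I x).symm (extChartAt I x x) with hpdef
    change g.coord x p (coordVec I x p (σ p)) (mvfderiv I (fun y ↦ coordVec I x y (τ y)) x v) +
      (g.coord x p (mvfderiv I (fun y ↦ coordVec I x y (σ y)) x v) (coordVec I x p (τ p)) +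
       mvfderiv I (g.coord x) x v (coordVec I x p (σ p)) (coordVec I x p (τ p))) = _
    rw [hp, dCoord]
    ring
  have h8 : ∀ a b, g.coord x x a (coordVec I x x b) = g.inner x (ofCoordVec I x x a) b := by
    intro a b
    change g.inner x (ofCoordVec I x x a) (ofCoordVec I x x (coordVec I x x b)) = _
    rw [ofCoordVec_coordVec]
  rw [h7, g.coord_symm x x (coordVec I x x (σ x)), h8, h8, g.dCoord_symm x v (τ x) (σ x),
    g.dCoord_symm x (τ x) v (σ x),  g.symm x (σ x) (ofCoordVec I x x _),
    g.dCoord_symm x (σ x) v (τ x)]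
  ring


lemma extend_eq_ofCoordVec {x y : M} (hy : y ∈ (trivializationAt E (TangentSpace I) x).baseSet)
   (v : TangentSpace I x) : FiberBundle.extend E v y = ofCoordVec I x y (coordVec I x x v) := by
  have hx := FiberBundle.mem_baseSet_trivializationAt' (F := E) (E := (TangentSpace I : M → Type _)) x
  simp only [FiberBundle.extend, ofCoordVec, coordVec]
  rw [Trivialization.symmL_apply, Trivialization.continuousLinearMapAt_apply, Trivialization.linearMapAt_apply,
    if_pos hx]
  exact hy

lemma leviCivita_extend (x : M) (v w : TangentSpace I x) : g.leviCivita (FiberBundle.extend E w) x v =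
    g.christoffel x v w := by
  have hx := FiberBundle.mem_baseSet_trivializationAt' (F := E) (E := (TangentSpace I : M → Type _)) x
  have h6 : ∀ (σ : Π x : M, TangentSpace I x), g.leviCivita σ x v =
     ofCoordVec I x x (mvfderiv I (fun y ↦ coordVec I x y (σ y)) x v) + g.christoffel x v (σ x) :=
    fun _ ↦ rfl
  rw [h6, FiberBundle.extend_apply_self]
  have : (fun y ↦ coordVec I x y (FiberBundle.extend E w y)) =ᶠ[nhds x] fun _ ↦ coordVec I x x w := by
    filter_upwards [(trivializationAt E (TangentSpace I) x).open_baseSet.mem_nhds hx] with y hy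
    rw [extend_eq_ofCoordVec hy]
    exact (trivializationAt E (TangentSpace I) x).continuousLinearMapAt_symmL hy _
  have h : mvfderiv I (fun y ↦ coordVec I x y (FiberBundle.extend E w y)) x = 0 := by
    ext v
    have := DFunLike.congr_fun (this.mfderiv_eq (I := I) (I' := 𝓘(ℝ, E))) v
    refine this.trans ?_
    rw [mfderiv_const]
    rfl
  rw [h]
  simp

lemma mlieBracket_extend (x : M) (v w : TangentSpace I x) :
    VectorField.mlieBracket I (FiberBundle.extend E v) (FiberBundle.extend E w) x = 0 := by
  have key : ∀ v : TangentSpace I x,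
     VectorField.mpullbackWithin 𝓘(ℝ, E) I (extChartAt I x).symm (FiberBundle.extend E v) (Set.range I)
       =ᶠ[nhdsWithin (extChartAt I x x) (Set.range I)] fun _ ↦ coordVec I x x v := by
    intro v
    filter_upwards [extChartAt_target_mem_nhdsWithin x] with z hz
    have hs := (extChartAt I x).map_target hz
    have hb : (extChartAt I x).symm z ∈ (trivializationAt E (TangentSpace I) x).baseSet := by
      simpa using hs
    rw [VectorField.mpullbackWithin_apply, extend_eq_ofCoordVec hb]
    have h1 := TangentBundle.symmL_trivializationAt (I := I) (by simpa using hs : (extChartAt I x).symm z ∈ (chartAt H x).source)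
    rw [(extChartAt I x).right_inv hz] at h1
    rw [ofCoordVec, h1]
    exact (isInvertible_mfderivWithin_extChartAt_symm hz).inverse_apply_eq.2 rfl
  rw [VectorField.mlieBracket, VectorField.mlieBracketWithin_apply]
  have : VectorField.lieBracketWithin ℝ (VectorField.mpullbackWithin 𝓘(ℝ, E) I (extChartAt I x).symm (FiberBundle.extend E v) (Set.range I))
    (VectorField.mpullbackWithin 𝓘(ℝ, E) I (extChartAt I x).symm (FiberBundle.extend E w) (Set.range I))
     ((extChartAt I x).symm ⁻¹' Set.univ ∩ Set.range I) (extChartAt I x x) = 0 := by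
    simp only [Set.preimage_univ, Set.univ_inter]
    rw [Filter.EventuallyEq.lieBracketWithin_vectorField_eq_of_mem (key v) (key w) (by simp)]
    simp [VectorField.lieBracketWithin]
  rw [this]
  exact map_zero _

/-- The connection `leviCivita` is torsion-free. -/
theorem leviCivita_torsion : g.leviCivita.torsion = 0 := by
  ext x v w
  rw [CovariantDerivative.torsion_apply_eq_extend]
  rw [mlieBracket_extend, FiberBundle.extend_apply_self, FiberBundle.extend_apply_self,
    leviCivita_extend, leviCivita_extend, christoffel_symm]
  simp

/-- The gradient of a function: `g(grad u, ·) = du`. -/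
def grad (u : M → ℝ) (x : M) : TangentSpace I x :=
  (g.flat x).symm (mvfderiv I u x).toLinearMap

/-- The covariant derivative of a one-form, `(∇_v θ)(Y) = v(θ(Y)) - θ(∇_v Y)`. -/
def covDerivOneForm (θ : Π x : M, TangentSpace I x →L[ℝ] ℝ) (Y : Π x : M, TangentSpace I x)
    (x : M) (v : TangentSpace I x) : ℝ :=
  mvfderiv I (fun y ↦ θ y (Y y)) x v - θ x (g.leviCivita Y x v)

/-- The Hessian `∇du` of `u`, that is `(∇_v du)(Y)`, at `x`. -/
def hessian (u : M → ℝ) (Y : Π x : M, TangentSpace I x) (x : M) (v : TangentSpace I x) : ℝ :=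
  g.covDerivOneForm (fun y ↦ mvfderiv I u y) Y x v

/-- A vector field is parallel if its covariant derivative for the Levi-Civita connection
vanishes. -/
def IsParallel (V : Π x : M, TangentSpace I x) : Prop :=
  ∀ x : M, g.leviCivita V x = 0

end SemiRiemannianMetric

end General

section Cone

/-- The open set of positive real numbers. -/
def posReal : TopologicalSpace.Opens ℝ := ⟨Set.Ioi 0, isOpen_Ioi⟩

variable {E : Type*} [NormedAddCommGroup E] [NormedSpace ℝ E]
  {H : Type*} [TopologicalSpace H] {I : ModelWithCorners ℝ E H}
  {M : Type*} [TopologicalSpace M] [ChartedSpace H M] [IsManifold I ∞ M]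

variable (M) in
/-- The manifold `ℝ_{>0} × M`. -/
abbrev Cone : Type _ := posReal × M

variable (I) in
/-- The model with corners of `ℝ_{>0} × M`. -/
abbrev coneModel : ModelWithCorners ℝ (ℝ × E) (ModelProd ℝ H) := 𝓘(ℝ, ℝ).prod I

variable (I) in
/-- The radial vector field `∂_r`. -/
def radialField (q : Cone M) : TangentSpace (coneModel I) q := ((1 : ℝ), (0 : E))

/-- The vector at `(r, p)` tangent to `{r} × M` given by a tangent vector `v` of `M` at `p`. -/
def horizontalLift (q : Cone M) (v : TangentSpace I q.2) : TangentSpace (coneModel I) q :=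
  ((0 : ℝ), (v : E))

variable (I) in
/-- The differential of the function `r` on the cone, see `mfderiv_radius`. -/
def dRadius (q : Cone M) : TangentSpace (coneModel I) q →L[ℝ] ℝ := ContinuousLinearMap.fst ℝ ℝ E

variable (I) in
/-- The differential of the projection to `M`, see `mfderiv_proj`. -/
def dProj (q : Cone M) : TangentSpace (coneModel I) q →L[ℝ] TangentSpace I q.2 :=
  ContinuousLinearMap.snd ℝ ℝ E

lemma hasMFDerivAt_posReal_val (r : posReal) :
    HasMFDerivAt 𝓘(ℝ, ℝ) 𝓘(ℝ, ℝ) (Subtype.val : posReal → ℝ) r (ContinuousLinearMap.id ℝ ℝ) := by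
  refine ⟨continuous_subtype_val.continuousAt, ?_⟩
  have hmem : (extChartAt 𝓘(ℝ, ℝ) r).target ∈ nhds (extChartAt 𝓘(ℝ, ℝ) r r) :=
    extChartAt_target_mem_nhds r
  refine ((hasFDerivAt_id _).congr_of_eventuallyEq ?_).hasFDerivWithinAt
  filter_upwards [hmem] with t ht
  exact (extChartAt 𝓘(ℝ, ℝ) r).right_inv ht

lemma mfderiv_radius (q : Cone M) :
    mfderiv (coneModel I) 𝓘(ℝ, ℝ) (fun q : Cone M ↦ (q.1 : ℝ)) q = dRadius I q :=
  ((hasMFDerivAt_posReal_val q.1).comp q (hasMFDerivAt_fst q)).mfderiv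

lemma mfderiv_proj (q : Cone M) :
    mfderiv (coneModel I) I (fun q : Cone M ↦ q.2) q = dProj I q :=
  mfderiv_snd

lemma contMDiff_radius :
    ContMDiff (coneModel I) 𝓘(ℝ, ℝ) ∞ (fun q : Cone M ↦ (q.1 : ℝ)) :=
  contMDiff_subtype_val.comp contMDiff_fst

/-- The tensor `ε dr² + r² g`. -/
def coneInner (ε : ℝ) (g : SemiRiemannianMetric I M) (q : Cone M) :
    TangentSpace (coneModel I) q →L[ℝ] TangentSpace (coneModel I) q →L[ℝ] ℝ :=
  ε • (dRadius I q).smulRight (dRadius I q) +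
    (q.1 : ℝ) ^ 2 • ((dProj I q).precomp ℝ ∘L g.inner q.2 ∘L dProj I q)

lemma coneInner_apply (ε : ℝ) (g : SemiRiemannianMetric I M) (q : Cone M)
    (v w : TangentSpace (coneModel I) q) :
    coneInner ε g q v w =
      ε * (dRadius I q v * dRadius I q w) + (q.1 : ℝ) ^ 2 * g.inner q.2 (dProj I q v) (dProj I q w) :=
  rfl

lemma contMDiff_dRadius_sq : ContMDiff (coneModel I)
    ((coneModel I).prod 𝓘(ℝ, (ℝ × E) →L[ℝ] (ℝ × E) →L[ℝ] ℝ)) ∞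
    (fun q ↦ TotalSpace.mk' ((ℝ × E) →L[ℝ] (ℝ × E) →L[ℝ] ℝ)
      (E := fun q : Cone M ↦
        TangentSpace (coneModel I) q →L[ℝ] TangentSpace (coneModel I) q →L[ℝ] ℝ) q
      ((dRadius I q).smulRight (dRadius I q))) := by
  have h := contMDiff_pullback_form (I := 𝓘(ℝ, ℝ)) (M := ℝ) (fun _ ↦ ContinuousLinearMap.mul ℝ ℝ)
    (fun x ↦ (contMDiff_form_iff _ x).2 (by
      refine (contMDiffAt_const (c := ContinuousLinearMap.mul ℝ ℝ)).congr_of_eventuallyEq ?_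
      filter_upwards with y
      ext
      simp only [coordForm, ofCoordVec, TangentBundle.symmL_model_space]
      rfl)) (contMDiff_radius (I := I) (M := M))
  refine h.congr fun q ↦ ?_
  rw [mfderiv_radius]
  rfl

lemma contMDiff_coneInner (ε : ℝ) (g : SemiRiemannianMetric I M) : ContMDiff (coneModel I)
    ((coneModel I).prod 𝓘(ℝ, (ℝ × E) →L[ℝ] (ℝ × E) →L[ℝ] ℝ)) ∞
    (fun q ↦ TotalSpace.mk' ((ℝ × E) →L[ℝ] (ℝ × E) →L[ℝ] ℝ)
      (E := fun q : Cone M ↦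
        TangentSpace (coneModel I) q →L[ℝ] TangentSpace (coneModel I) q →L[ℝ] ℝ) q
      (coneInner ε g q)) := by
  have h := contMDiff_pullback_form g.inner g.contMDiff
    (contMDiff_snd (I := 𝓘(ℝ, ℝ)) (J := I) (M := posReal) (N := M))
  simp only [mfderiv_snd] at h
  intro q
  rw [contMDiff_form_iff]
  have h₁ := (contMDiff_form_iff _ q).1 (contMDiff_dRadius_sq (I := I) (M := M) q)
  have h₂ := (contMDiff_form_iff _ q).1 (h q)
  have h₃ := (contMDiff_radius (I := I) (M := M) q).pow 2
  exact ((contMDiffAt_const (I' := 𝓘(ℝ, ℝ)) (c := ε)).smul h₁).add (h₃.smul h₂)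

/-- The cone metric `ε dr² + r² g` with `ε = ± 1`. -/
def coneMetric (ε : ℝ) (hε : ε = 1 ∨ ε = -1) (g : SemiRiemannianMetric I M) :
    SemiRiemannianMetric (coneModel I) (Cone M) where
  inner := coneInner ε g
  symm q v w := by
    rw [coneInner_apply, coneInner_apply, g.symm, mul_comm (dRadius I q v)]
  nondegenerate q v hv := by
    have hr : (q.1 : ℝ) ^ 2 ≠ 0 := (pow_pos (show (0 : ℝ) < q.1 from q.1.2) 2).ne'
    have hε0 : ε ≠ 0 := by rcases hε with rfl | rfl <;> norm_num
    refine Prod.ext ?_ ?_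
    · have h := hv (radialField I q)
      rw [coneInner_apply] at h
      change ε * ((v : ℝ × E).1 * 1) + (q.1 : ℝ) ^ 2 *
        g.inner q.2 (dProj I q v) (0 : TangentSpace I q.2) = 0 at h
      have h' : (v : ℝ × E).1 = 0 := by simpa [hε0] using h
      exact h'
    · refine g.nondegenerate q.2 _ fun w ↦ ?_
      have h := hv (horizontalLift q w)
      rw [coneInner_apply] at h
      change ε * ((v : ℝ × E).1 * 0) + (q.1 : ℝ) ^ 2 *
        g.inner q.2 (v : ℝ × E).2 w = 0 at h
      have h' : g.inner q.2 (v : ℝ × E).2 w = 0 := by simpa [hr] using h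
      exact h'
  contMDiff := contMDiff_coneInner ε g

end Cone

end

/-!
The Christoffel symbols of `ĝ = ε dr² + r² g` give `∇̂_v ∂_r = v^M / r` and, for a vector field `Y`
on `M` lifted to the cone, `∇̂_v Y = ∇_{v^M} Y + (dr(v) / r) Y - ε r g(v^M, Y) ∂_r`, where `v^M` is
the component of `v` tangent to `M`. If `V` is parallel, then `d(ĝ(V, W))(v) = ĝ(V, ∇̂_v W)` for
every vector field `W`. With `W = ∂_r` this reads `d(ĝ(V, ∂_r))(v) = r g(V^M, v^M)`; hence
`ĝ(V, ∂_r)` is constant along rays, so it is a function `u` on `M`, and `V^M = ∇u / r`. With `W = Y`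
on the slice `r = 1` it becomes the Hessian equation for `u`.
-/

section ParallelFieldsOnCones

variable {E : Type*} [NormedAddCommGroup E] [NormedSpace ℝ E]
  {H : Type*} [TopologicalSpace H] {I : ModelWithCorners ℝ E H}
  {M : Type*} [TopologicalSpace M] [ChartedSpace H M]

section CoordinateFrame

variable [IsManifold I ∞ M] {x : M}

lemma ofCoordVec_coordVec_of_mem {y : M}
    (hy : y ∈ (trivializationAt E (TangentSpace I) x).baseSet) (v : TangentSpace I y) :
    ofCoordVec I x y (coordVec I x y v) = v :=
  (trivializationAt E (TangentSpace I) x).symmL_continuousLinearMapAt hy v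

lemma coordVec_ofCoordVec_of_mem {y : M}
    (hy : y ∈ (trivializationAt E (TangentSpace I) x).baseSet) (e : E) :
    coordVec I x y (ofCoordVec I x y e) = e :=
  (trivializationAt E (TangentSpace I) x).continuousLinearMapAt_symmL hy e

lemma coordVec_eventuallyEq_trivializationAt_snd (σ : Π y : M, TangentSpace I y) :
    (fun y ↦ coordVec I x y (σ y)) =ᶠ[nhds x]
      fun y ↦ (trivializationAt E (TangentSpace I) x ⟨y, σ y⟩).2 := by
  filter_upwards [(trivializationAt E (TangentSpace I) x).open_baseSet.mem_nhds
    (FiberBundle.mem_baseSet_trivializationAt' x)] with y hy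
  rw [coordVec, Trivialization.continuousLinearMapAt_apply, Trivialization.linearMapAt_apply,
    if_pos hy]

lemma mdifferentiableAt_coordVec_iff {σ : Π y : M, TangentSpace I y} :
    MDiffAt (fun y ↦ coordVec I x y (σ y)) x ↔ MDiffAt (T% σ) x := by
  rw [mdifferentiableAt_section]
  exact (coordVec_eventuallyEq_trivializationAt_snd σ).mdifferentiableAt_iff

lemma contMDiffAt_coordVec_iff {n : WithTop ℕ∞} {σ : Π y : M, TangentSpace I y} :
    ContMDiffAt I 𝓘(ℝ, E) n (fun y ↦ coordVec I x y (σ y)) x ↔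
      ContMDiffAt I I.tangent n (fun y ↦ (⟨y, σ y⟩ : TangentBundle I M)) x := by
  refine Iff.trans ?_ (contMDiffAt_section x).symm
  exact (coordVec_eventuallyEq_trivializationAt_snd σ).contMDiffAt_iff

end CoordinateFrame


namespace SemiRiemannianMetric

section Inner

variable [IsManifold I ∞ M] (g : SemiRiemannianMetric I M) {x : M}

lemma eq_of_inner_eq {v w : TangentSpace I x} (h : ∀ z, g.inner x v z = g.inner x w z) : v = w :=
  sub_eq_zero.1 <| g.nondegenerate x _ fun z ↦ by rw [map_sub, _root_.sub_apply, h, sub_self]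

variable [FiniteDimensional ℝ E]

lemma inner_grad (u : M → ℝ) (w : TangentSpace I x) :
    g.inner x (g.grad u x) w = mvfderiv I u x w :=
  g.inner_flat_symm x _ w

lemma mdifferentiableAt_inner {σ τ : Π y : M, TangentSpace I y}
    (hσ : MDiffAt (T% σ) x) (hτ : MDiffAt (T% τ) x) :
    MDiffAt (fun y ↦ g.inner y (σ y) (τ y)) x := by
  refine (((g.mdifferentiableAt_coord x).clm_apply (mdifferentiableAt_coordVec hσ)).clm_apply
    (mdifferentiableAt_coordVec hτ)).congr_of_eventuallyEq ?_
  filter_upwards [(trivializationAt E (TangentSpace I) x).open_baseSet.mem_nhds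
    (FiberBundle.mem_baseSet_trivializationAt' x)] with y hy
  exact (g.coord_coordVec hy _ _).symm

lemma hasMFDerivAt_coord_apply (e e' : E) :
    HasMFDerivAt I 𝓘(ℝ, ℝ) (fun y ↦ g.coord x y e e') x
      ((ContinuousLinearMap.apply ℝ ℝ e' ∘L ContinuousLinearMap.apply ℝ (E →L[ℝ] ℝ) e) ∘L
        mvfderiv I (g.coord x) x) := by
  have heval : HasMFDerivAt 𝓘(ℝ, E →L[ℝ] E →L[ℝ] ℝ) 𝓘(ℝ, ℝ)
      (ContinuousLinearMap.apply ℝ ℝ e' ∘L ContinuousLinearMap.apply ℝ (E →L[ℝ] ℝ) e)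
      (g.coord x x)
      (ContinuousLinearMap.apply ℝ ℝ e' ∘L ContinuousLinearMap.apply ℝ (E →L[ℝ] ℝ) e) :=
    (ContinuousLinearMap.hasFDerivAt _).hasMFDerivAt
  exact heval.comp x (g.mdifferentiableAt_coord x).hasMFDerivAt

lemma dCoord_eq_mvfderiv (v w z : TangentSpace I x) :
    g.dCoord x v w z =
      mvfderiv I (fun y ↦ g.coord x y (coordVec I x x w) (coordVec I x x z)) x v :=
  (DFunLike.congr_fun (g.hasMFDerivAt_coord_apply _ _).mfderiv v).symm

lemma leviCivita_apply (σ : Π y : M, TangentSpace I y) (v : TangentSpace I x) :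
    g.leviCivita σ x v =
      ofCoordVec I x x (mvfderiv I (fun y ↦ coordVec I x y (σ y)) x v) +
        g.christoffel x v (σ x) :=
  rfl

variable {g} in
lemma IsParallel.mvfderiv_inner {V W : Π y : M, TangentSpace I y} (hpar : g.IsParallel V)
    (hV : MDiffAt (T% V) x) (hW : MDiffAt (T% W) x) (v : TangentSpace I x) :
    mvfderiv I (fun y ↦ g.inner y (V y) (W y)) x v = g.inner x (V x) (g.leviCivita W x v) := by
  rw [g.leviCivita_metric hV hW, hpar x, _root_.zero_apply, map_zero, _root_.zero_apply, zero_add]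

end Inner

end SemiRiemannianMetric

lemma posReal_coe_ne_zero (r : posReal) : (r : ℝ) ≠ 0 := ne_of_gt r.2

section ConeLinearAlgebra

variable {q : Cone M}

@[simp] lemma dRadius_radialField : dRadius I q (radialField I q) = 1 := rfl

@[simp] lemma dProj_radialField : dProj I q (radialField I q) = 0 := rfl

@[simp] lemma dRadius_horizontalLift (v : TangentSpace I q.2) :
    dRadius I q (horizontalLift q v) = 0 := rfl

@[simp] lemma dProj_horizontalLift (v : TangentSpace I q.2) :
    dProj I q (horizontalLift q v) = v := rfl

lemma eq_of_dRadius_eq_of_dProj_eq {v w : TangentSpace (coneModel I) q}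
    (hr : dRadius I q v = dRadius I q w) (hp : dProj I q v = dProj I q w) : v = w :=
  Prod.ext hr hp

variable [IsManifold I ∞ M] (ε : ℝ) (hε : ε = 1 ∨ ε = -1) (g : SemiRiemannianMetric I M)

lemma coneMetric_inner_apply (v w : TangentSpace (coneModel I) q) :
    (coneMetric ε hε g).inner q v w =
      ε * (dRadius I q v * dRadius I q w) +
        (q.1 : ℝ) ^ 2 * g.inner q.2 (dProj I q v) (dProj I q w) :=
  rfl

lemma coneMetric_inner_radialField (v : TangentSpace (coneModel I) q) :
    (coneMetric ε hε g).inner q v (radialField I q) = ε * dRadius I q v := by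
  simp [coneMetric_inner_apply]

lemma coneMetric_inner_horizontalLift (v : TangentSpace (coneModel I) q)
    (w : TangentSpace I q.2) :
    (coneMetric ε hε g).inner q v (horizontalLift q w) =
      (q.1 : ℝ) ^ 2 * g.inner q.2 (dProj I q v) w := by
  simp [coneMetric_inner_apply]

end ConeLinearAlgebra

section ConeCoordinates

variable {q q' : Cone M}

lemma extChartAt_cone (q : Cone M) :
    (extChartAt (coneModel I) q : Cone M → ℝ × E) =
      fun q' ↦ ((q'.1 : ℝ), extChartAt I q.2 q'.2) := by
  rw [extChartAt_prod]
  rfl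

lemma hasMFDerivAt_radius (q : Cone M) :
    HasMFDerivAt (coneModel I) 𝓘(ℝ, ℝ) (fun q : Cone M ↦ (q.1 : ℝ)) q (dRadius I q) :=
  (hasMFDerivAt_posReal_val q.1).comp q (hasMFDerivAt_fst q)

variable [IsManifold I ∞ M]

lemma mem_baseSet_cone (hq : q'.2 ∈ (trivializationAt E (TangentSpace I) q.2).baseSet) :
    q' ∈ (trivializationAt (ℝ × E) (TangentSpace (coneModel I)) q).baseSet := by
  rw [TangentBundle.trivializationAt_baseSet] at hq ⊢
  rw [prodChartedSpace_chartAt]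
  exact ⟨by simp [TopologicalSpace.Opens.chartAt_eq, chartAt_self_eq], hq⟩

lemma eventually_mem_baseSet_cone (q : Cone M) :
    ∀ᶠ q' : Cone M in nhds q, q'.2 ∈ (trivializationAt E (TangentSpace I) q.2).baseSet :=
  continuous_snd.continuousAt.eventually_mem
    ((trivializationAt E (TangentSpace I) q.2).open_baseSet.mem_nhds
      (FiberBundle.mem_baseSet_trivializationAt' q.2))

lemma coordVec_cone (hq : q'.2 ∈ (trivializationAt E (TangentSpace I) q.2).baseSet)
    (v : TangentSpace (coneModel I) q') :
    coordVec (coneModel I) q q' v = (dRadius I q' v, coordVec I q.2 q'.2 (dProj I q' v)) := by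
  have hq' := mem_baseSet_cone hq
  rw [TangentBundle.trivializationAt_baseSet] at hq hq'
  rw [coordVec, coordVec, TangentBundle.continuousLinearMapAt_trivializationAt hq',
    TangentBundle.continuousLinearMapAt_trivializationAt hq, extChartAt_cone]
  have hproj := (mdifferentiableAt_extChartAt (I := I) hq).hasMFDerivAt.comp q'
    (hasMFDerivAt_snd (I := 𝓘(ℝ, ℝ)) q')
  have hradius := hasMFDerivAt_radius (I := I) q'
  have hchart : HasMFDerivAt (coneModel I) 𝓘(ℝ, ℝ × E)
      (fun q' : Cone M ↦ ((q'.1 : ℝ), extChartAt I q.2 q'.2)) q' _ :=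
    ⟨hradius.1.prodMk hproj.1, hradius.2.prodMk hproj.2⟩
  exact DFunLike.congr_fun hchart.mfderiv v

lemma ofCoordVec_cone (hq : q'.2 ∈ (trivializationAt E (TangentSpace I) q.2).baseSet)
    (e : ℝ × E) :
    ofCoordVec (coneModel I) q q' e =
      e.1 • radialField I q' + horizontalLift q' (ofCoordVec I q.2 q'.2 e.2) := by
  set v := e.1 • radialField I q' + horizontalLift q' (ofCoordVec I q.2 q'.2 e.2)
  have hv : coordVec (coneModel I) q q' v = e := by
    rw [coordVec_cone hq]
    ext <;> simp [v, coordVec_ofCoordVec_of_mem hq]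
  rw [← hv, ofCoordVec_coordVec_of_mem (mem_baseSet_cone hq)]

variable (ε : ℝ) (hε : ε = 1 ∨ ε = -1) (g : SemiRiemannianMetric I M)

lemma coord_cone (hq : q'.2 ∈ (trivializationAt E (TangentSpace I) q.2).baseSet)
    (e e' : ℝ × E) :
    (coneMetric ε hε g).coord q q' e e' =
      ε * (e.1 * e'.1) + (q'.1 : ℝ) ^ 2 * g.coord q.2 q'.2 e.2 e'.2 := by
  change (coneMetric ε hε g).inner q' (ofCoordVec (coneModel I) q q' e)
    (ofCoordVec (coneModel I) q q' e') = _
  rw [ofCoordVec_cone hq, ofCoordVec_cone hq, coneMetric_inner_apply]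
  simp only [map_add, map_smul, dRadius_radialField, dRadius_horizontalLift, dProj_radialField,
    dProj_horizontalLift, smul_eq_mul, mul_one, add_zero, smul_zero, zero_add]
  rfl

variable [FiniteDimensional ℝ E]

lemma dCoord_cone (v w z : TangentSpace (coneModel I) q) :
    (coneMetric ε hε g).dCoord q v w z =
      2 * (q.1 : ℝ) * dRadius I q v * g.inner q.2 (dProj I q w) (dProj I q z) +
        (q.1 : ℝ) ^ 2 * g.dCoord q.2 (dProj I q v) (dProj I q w) (dProj I q z) := by
  have hq : q.2 ∈ (trivializationAt E (TangentSpace I) q.2).baseSet :=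
    FiberBundle.mem_baseSet_trivializationAt' q.2
  set e := coordVec I q.2 q.2 (dProj I q w)
  set e' := coordVec I q.2 q.2 (dProj I q z)
  have hcoord : (fun q' ↦ (coneMetric ε hε g).coord q q' (dRadius I q w, e) (dRadius I q z, e'))
      =ᶠ[nhds q] fun q' ↦ ε * (dRadius I q w * dRadius I q z) +
        (q'.1 : ℝ) ^ 2 * g.coord q.2 q'.2 e e' := by
    filter_upwards [eventually_mem_baseSet_cone (I := I) q] with q' hq'
    exact coord_cone ε hε g hq' _ _
  have hsq := (hasDerivAt_pow 2 (q.1 : ℝ)).hasFDerivAt.hasMFDerivAt.comp q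
    (hasMFDerivAt_radius (I := I) q)
  have hg := (g.hasMFDerivAt_coord_apply e e').comp q (hasMFDerivAt_snd (I := 𝓘(ℝ, ℝ)) q)
  have hderiv := ((hasMFDerivAt_const (ε * (dRadius I q w * dRadius I q z)) q).add
    (hsq.mul hg)).congr_of_eventuallyEq hcoord
  rw [SemiRiemannianMetric.dCoord_eq_mvfderiv, coordVec_cone hq, coordVec_cone hq,
    ← g.coord_coordVec hq]
  refine (DFunLike.congr_fun hderiv.mfderiv v).trans ?_
  change 0 + ((q.1 : ℝ) ^ 2 * g.dCoord q.2 (dProj I q v) (dProj I q w) (dProj I q z) +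
    g.coord q.2 q.2 e e' * (dRadius I q v * _)) = _
  simp only [Nat.cast_ofNat, Nat.add_one_sub_one, pow_one, zero_add]
  ring

lemma christoffel_cone (v w : TangentSpace (coneModel I) q) :
    (coneMetric ε hε g).christoffel q v w =
      (-ε * q.1 * g.inner q.2 (dProj I q v) (dProj I q w)) • radialField I q +
        horizontalLift q (g.christoffel q.2 (dProj I q v) (dProj I q w) +
          (1 / (q.1 : ℝ)) • (dRadius I q v • dProj I q w + dRadius I q w • dProj I q v)) := by
  have hr := posReal_coe_ne_zero q.1
  have hε2 : ε * ε = 1 := by rcases hε with rfl | rfl <;> norm_num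
  refine (coneMetric ε hε g).eq_of_inner_eq fun z ↦ ?_
  rw [SemiRiemannianMetric.inner_christoffel, dCoord_cone, dCoord_cone, dCoord_cone,
    coneMetric_inner_apply]
  simp only [map_add, map_smul, dRadius_radialField, dRadius_horizontalLift, dProj_radialField,
    dProj_horizontalLift, smul_zero, zero_add, _root_.add_apply, _root_.smul_apply,
    g.inner_christoffel, smul_eq_mul]
  field_simp
  linear_combination (2 * g.inner q.2 (dProj I q v) (dProj I q w) * dRadius I q z * q.1) * hε2

end ConeCoordinates

section ConeConnection

variable [IsManifold I ∞ M] {q : Cone M}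

lemma coordVec_radialField_eventuallyEq (q : Cone M) :
    (fun q' : Cone M ↦ coordVec (coneModel I) q q' (radialField I q')) =ᶠ[nhds q]
      fun _ ↦ ((1 : ℝ), (0 : E)) := by
  filter_upwards [eventually_mem_baseSet_cone (I := I) q] with q' hq'
  simp [coordVec_cone hq']

lemma hasMFDerivAt_coordVec_horizontalLift {Y : Π x : M, TangentSpace I x}
    (hY : MDiffAt (T% Y) q.2) :
    HasMFDerivAt (coneModel I) 𝓘(ℝ, ℝ × E)
      (fun q' : Cone M ↦ coordVec (coneModel I) q q' (horizontalLift q' (Y q'.2))) q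
      (ContinuousLinearMap.inr ℝ ℝ E ∘L
        mvfderiv I (fun y ↦ coordVec I q.2 y (Y y)) q.2 ∘L dProj I q) := by
  have hcoord : (fun q' : Cone M ↦ coordVec (coneModel I) q q' (horizontalLift q' (Y q'.2)))
      =ᶠ[nhds q] fun q' ↦ ContinuousLinearMap.inr ℝ ℝ E (coordVec I q.2 q'.2 (Y q'.2)) := by
    filter_upwards [eventually_mem_baseSet_cone (I := I) q] with q' hq'
    simp [coordVec_cone hq']
  have hYcoord := (mdifferentiableAt_coordVec_iff.2 hY).hasMFDerivAt.comp q
    (hasMFDerivAt_snd (I := 𝓘(ℝ, ℝ)) q)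
  exact ((ContinuousLinearMap.inr ℝ ℝ E).hasFDerivAt.hasMFDerivAt.comp q
    hYcoord).congr_of_eventuallyEq hcoord

lemma mdifferentiableAt_radialField (q : Cone M) :
    MDifferentiableAt (coneModel I) (coneModel I).tangent
      (fun q' ↦ (⟨q', radialField I q'⟩ : TangentBundle (coneModel I) (Cone M))) q :=
  mdifferentiableAt_coordVec_iff.1 <|
    mdifferentiableAt_const.congr_of_eventuallyEq (coordVec_radialField_eventuallyEq q)

lemma mdifferentiableAt_horizontalLift {Y : Π x : M, TangentSpace I x}
    (hY : MDiffAt (T% Y) q.2) :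
    MDifferentiableAt (coneModel I) (coneModel I).tangent
      (fun q' ↦ (⟨q', horizontalLift q' (Y q'.2)⟩ : TangentBundle (coneModel I) (Cone M))) q :=
  mdifferentiableAt_coordVec_iff.1 (hasMFDerivAt_coordVec_horizontalLift hY).mdifferentiableAt

lemma contMDiff_dRadius_apply {n : WithTop ℕ∞} {V : Π q : Cone M, TangentSpace (coneModel I) q}
    (hV : ContMDiff (coneModel I) (coneModel I).tangent n
      (fun q ↦ (⟨q, V q⟩ : TangentBundle (coneModel I) (Cone M)))) :
    ContMDiff (coneModel I) 𝓘(ℝ, ℝ) n (fun q ↦ dRadius I q (V q)) := by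
  intro q
  have hfst : ContMDiff 𝓘(ℝ, ℝ × E) 𝓘(ℝ, ℝ) n (Prod.fst : ℝ × E → ℝ) := contDiff_fst.contMDiff
  refine (hfst.contMDiffAt.comp q (contMDiffAt_coordVec_iff.2 (hV q))).congr_of_eventuallyEq ?_
  filter_upwards [eventually_mem_baseSet_cone (I := I) q] with q' hq'
  simp [coordVec_cone hq']

variable [FiniteDimensional ℝ E] (ε : ℝ) (hε : ε = 1 ∨ ε = -1) (g : SemiRiemannianMetric I M)

lemma leviCivita_radialField (v : TangentSpace (coneModel I) q) :
    (coneMetric ε hε g).leviCivita (radialField I) q v =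
      (1 / (q.1 : ℝ)) • horizontalLift q (dProj I q v) := by
  have hconst : mvfderiv (coneModel I)
      (fun q' ↦ coordVec (coneModel I) q q' (radialField I q')) q v = 0 :=
    DFunLike.congr_fun ((hasMFDerivAt_const (I := coneModel I) ((1 : ℝ), (0 : E))
      q).congr_of_eventuallyEq (coordVec_radialField_eventuallyEq q)).mfderiv v
  rw [SemiRiemannianMetric.leviCivita_apply, hconst, map_zero, zero_add, christoffel_cone]
  apply eq_of_dRadius_eq_of_dProj_eq <;> simp

lemma leviCivita_horizontalLift {Y : Π x : M, TangentSpace I x} (hY : MDiffAt (T% Y) q.2)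
    (v : TangentSpace (coneModel I) q) :
    (coneMetric ε hε g).leviCivita (fun q' ↦ horizontalLift q' (Y q'.2)) q v =
      (-ε * q.1 * g.inner q.2 (dProj I q v) (Y q.2)) • radialField I q +
        horizontalLift q (g.leviCivita Y q.2 (dProj I q v) +
          (dRadius I q v / q.1) • Y q.2) := by
  have hderiv : mvfderiv (coneModel I)
      (fun q' ↦ coordVec (coneModel I) q q' (horizontalLift q' (Y q'.2))) q v =
        (0, mvfderiv I (fun y ↦ coordVec I q.2 y (Y y)) q.2 (dProj I q v)) :=
    DFunLike.congr_fun (hasMFDerivAt_coordVec_horizontalLift hY).mfderiv v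
  rw [SemiRiemannianMetric.leviCivita_apply, hderiv, g.leviCivita_apply, christoffel_cone,
    ofCoordVec_cone (FiberBundle.mem_baseSet_trivializationAt' q.2)]
  apply eq_of_dRadius_eq_of_dProj_eq
  · simp
  · simp [add_assoc, smul_smul, div_eq_inv_mul]

end ConeConnection

section Rays

lemma hasMFDerivAt_exp_ray (p : M) (t : ℝ) :
    HasMFDerivAt 𝓘(ℝ, ℝ) (coneModel I)
      (fun t ↦ ((⟨Real.exp t, Real.exp_pos t⟩, p) : Cone M)) t
      (ContinuousLinearMap.toSpanSingleton ℝ (Real.exp t • radialField I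
        ((⟨Real.exp t, Real.exp_pos t⟩, p) : Cone M))) := by
  have hexp : HasMFDerivAt 𝓘(ℝ, ℝ) 𝓘(ℝ, ℝ)
      (fun t ↦ (⟨Real.exp t, Real.exp_pos t⟩ : posReal)) t
      (ContinuousLinearMap.toSpanSingleton ℝ (Real.exp t)) :=
    ⟨(Real.continuous_exp.subtype_mk _).continuousAt,
      (Real.hasDerivAt_exp t).hasFDerivAt.hasFDerivWithinAt⟩
  refine (hexp.prodMk (hasMFDerivAt_const (I' := I) p t)).congr_mfderiv ?_
  ext
  · change 1 * Real.exp t = 1 * (Real.exp t * 1)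
    ring
  · change (0 : E) = (1 : ℝ) • Real.exp t • (0 : E)
    rw [smul_zero, smul_zero]

lemma eq_of_mvfderiv_radialField_eq_zero {f : Cone M → ℝ}
    (hf : MDifferentiable (coneModel I) 𝓘(ℝ, ℝ) f)
    (hf₀ : ∀ q, mvfderiv (coneModel I) f q (radialField I q) = 0) (r s : posReal) (p : M) :
    f (r, p) = f (s, p) := by
  -- Parametrising the ray by `exp` makes its domain all of `ℝ`.
  let ray : ℝ → Cone M := fun t ↦ (⟨Real.exp t, Real.exp_pos t⟩, p)
  have hray_log (r : posReal) : ray (Real.log r) = (r, p) :=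
    Prod.ext (Subtype.ext (Real.exp_log r.2)) rfl
  have hderiv (t : ℝ) : HasFDerivAt (f ∘ ray) (0 : ℝ →L[ℝ] ℝ) t := by
    refine (((hf (ray t)).hasMFDerivAt.comp t (hasMFDerivAt_exp_ray p t)).congr_mfderiv
      ?_).hasFDerivAt
    ext
    change mvfderiv (coneModel I) f (ray t) ((1 : ℝ) • Real.exp t • radialField I (ray t)) = 0
    rw [map_smul, map_smul, hf₀, smul_zero, smul_zero]
  have hconst := is_const_of_fderiv_eq_zero (𝕜 := ℝ) (fun t ↦ (hderiv t).differentiableAt)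
    (fun t ↦ (hderiv t).fderiv) (Real.log r) (Real.log s)
  simpa only [Function.comp_apply, hray_log] using hconst

end Rays

section ParallelField

lemma mvfderiv_comp_prodMk {f : Cone M → ℝ} {q : Cone M}
    (hf : MDifferentiableAt (coneModel I) 𝓘(ℝ, ℝ) f q) (v : TangentSpace I q.2) :
    mvfderiv I (f ∘ Prod.mk q.1) q.2 v = mvfderiv (coneModel I) f q (horizontalLift q v) := by
  have hslice : MDifferentiableAt I (coneModel I) (Prod.mk q.1) q.2 :=
    mdifferentiableAt_const.prodMk mdifferentiableAt_id
  rw [mvfderiv_comp_apply q.2 hf hslice, mfderiv_prod_right]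
  rfl

variable [IsManifold I ∞ M] [FiniteDimensional ℝ E] {g : SemiRiemannianMetric I M} {ε : ℝ}
  {hε : ε = 1 ∨ ε = -1} {V : Π q : Cone M, TangentSpace (coneModel I) q}

lemma mvfderiv_inner_radialField_of_isParallel (hpar : (coneMetric ε hε g).IsParallel V)
    (hV : MDifferentiable (coneModel I) (coneModel I).tangent
      (fun q ↦ (⟨q, V q⟩ : TangentBundle (coneModel I) (Cone M))))
    (q : Cone M) (v : TangentSpace (coneModel I) q) :
    mvfderiv (coneModel I) (fun q ↦ (coneMetric ε hε g).inner q (V q) (radialField I q)) q v =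
      q.1 * g.inner q.2 (dProj I q (V q)) (dProj I q v) := by
  have hr := posReal_coe_ne_zero q.1
  rw [hpar.mvfderiv_inner (hV q) (mdifferentiableAt_radialField q), leviCivita_radialField,
    map_smul, coneMetric_inner_horizontalLift, smul_eq_mul]
  field_simp

lemma coneMetric_inner_radialField_eq_of_isParallel (hpar : (coneMetric ε hε g).IsParallel V)
    (hV : MDifferentiable (coneModel I) (coneModel I).tangent
      (fun q ↦ (⟨q, V q⟩ : TangentBundle (coneModel I) (Cone M)))) (r s : posReal) (p : M) :
    (coneMetric ε hε g).inner (r, p) (V (r, p)) (radialField I (r, p)) =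
      (coneMetric ε hε g).inner (s, p) (V (s, p)) (radialField I (s, p)) :=
  eq_of_mvfderiv_radialField_eq_zero
    (fun q ↦ (coneMetric ε hε g).mdifferentiableAt_inner (hV q) (mdifferentiableAt_radialField q))
    (fun q ↦ by rw [mvfderiv_inner_radialField_of_isParallel hpar hV, dProj_radialField, map_zero,
      mul_zero]) r s p

variable {u : M → ℝ}

lemma mvfderiv_eq_mul_inner_dProj_of_isParallel (hpar : (coneMetric ε hε g).IsParallel V)
    (hV : MDifferentiable (coneModel I) (coneModel I).tangent
      (fun q ↦ (⟨q, V q⟩ : TangentBundle (coneModel I) (Cone M))))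
    (hu : ∀ q, (coneMetric ε hε g).inner q (V q) (radialField I q) = u q.2)
    (q : Cone M) (v : TangentSpace I q.2) :
    mvfderiv I u q.2 v = q.1 * g.inner q.2 (dProj I q (V q)) v := by
  have hslice : u = (fun q ↦ (coneMetric ε hε g).inner q (V q) (radialField I q)) ∘
      Prod.mk q.1 := funext fun p ↦ (hu (q.1, p)).symm
  have hinner := (coneMetric ε hε g).mdifferentiableAt_inner (hV q)
    (mdifferentiableAt_radialField q)
  conv_lhs => rw [hslice]
  rw [mvfderiv_comp_prodMk hinner, mvfderiv_inner_radialField_of_isParallel hpar hV,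
    dProj_horizontalLift]

lemma grad_eq_smul_dProj_of_isParallel (hpar : (coneMetric ε hε g).IsParallel V)
    (hV : MDifferentiable (coneModel I) (coneModel I).tangent
      (fun q ↦ (⟨q, V q⟩ : TangentBundle (coneModel I) (Cone M))))
    (hu : ∀ q, (coneMetric ε hε g).inner q (V q) (radialField I q) = u q.2) (q : Cone M) :
    g.grad u q.2 = (q.1 : ℝ) • dProj I q (V q) :=
  g.eq_of_inner_eq fun z ↦ by
    rw [g.inner_grad, mvfderiv_eq_mul_inner_dProj_of_isParallel hpar hV hu, map_smul,
      _root_.smul_apply, smul_eq_mul]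

lemma eq_radialField_add_horizontalLift_grad_of_isParallel
    (hpar : (coneMetric ε hε g).IsParallel V)
    (hV : MDifferentiable (coneModel I) (coneModel I).tangent
      (fun q ↦ (⟨q, V q⟩ : TangentBundle (coneModel I) (Cone M))))
    (hu : ∀ q, (coneMetric ε hε g).inner q (V q) (radialField I q) = u q.2) (q : Cone M) :
    V q = (ε * u q.2) • radialField I q +
      (1 / (q.1 : ℝ)) • horizontalLift q (g.grad u q.2) := by
  have hr := posReal_coe_ne_zero q.1
  have hε2 : ε * ε = 1 := by rcases hε with rfl | rfl <;> norm_num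
  rw [grad_eq_smul_dProj_of_isParallel hpar hV hu, ← hu, coneMetric_inner_radialField]
  apply eq_of_dRadius_eq_of_dProj_eq
  · simp [← mul_assoc, hε2]
  · simp [smul_smul, hr]

lemma hessian_eq_neg_mul_inner_of_isParallel (hpar : (coneMetric ε hε g).IsParallel V)
    (hV : MDifferentiable (coneModel I) (coneModel I).tangent
      (fun q ↦ (⟨q, V q⟩ : TangentBundle (coneModel I) (Cone M))))
    (hu : ∀ q, (coneMetric ε hε g).inner q (V q) (radialField I q) = u q.2)
    {p : M} (X : TangentSpace I p) {Y : Π x : M, TangentSpace I x} (hY : MDiffAt (T% Y) p) :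
    g.hessian u Y p X = -ε * u p * g.inner p X (Y p) := by
  -- On the slice `r = 1`, the function `du(Y)` is `ĝ(V, Y)` with no power of `r`.
  let one : posReal := ⟨1, one_pos (α := ℝ)⟩
  let q : Cone M := (one, p)
  set G := coneMetric ε hε g
  have hone : (one : ℝ) = 1 := rfl
  have hYlift := mdifferentiableAt_horizontalLift (q := q) hY
  have hslice : (fun y ↦ mvfderiv I u y (Y y)) =
      (fun q' ↦ G.inner q' (V q') (horizontalLift q' (Y q'.2))) ∘ Prod.mk one := by
    funext y
    rw [Function.comp_apply, coneMetric_inner_horizontalLift, hone, one_pow,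
      mvfderiv_eq_mul_inner_dProj_of_isParallel hpar hV hu (one, y), hone]
  have hderiv : mvfderiv I (fun y ↦ mvfderiv I u y (Y y)) p X =
      G.inner q (V q) (G.leviCivita (fun q' ↦ horizontalLift q' (Y q'.2)) q
        (horizontalLift q X)) := by
    rw [hslice]
    exact (mvfderiv_comp_prodMk (G.mdifferentiableAt_inner (hV q) hYlift) X).trans
      (hpar.mvfderiv_inner (hV q) hYlift _)
  rw [SemiRiemannianMetric.hessian, SemiRiemannianMetric.covDerivOneForm, hderiv,
    leviCivita_horizontalLift ε hε g hY, map_add, map_smul, hu, coneMetric_inner_horizontalLift,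
    mvfderiv_eq_mul_inner_dProj_of_isParallel hpar hV hu q, dProj_horizontalLift,
    dRadius_horizontalLift, zero_div, zero_smul, add_zero, hone, smul_eq_mul]
  ring

end ParallelField

end ParallelFieldsOnCones

theorem mainTheorem7_general
    {E : Type*} [NormedAddCommGroup E] [NormedSpace ℝ E] [FiniteDimensional ℝ E]
    {H : Type*} [TopologicalSpace H] {I : ModelWithCorners ℝ E H}
    {M : Type*} [TopologicalSpace M] [ChartedSpace H M] [IsManifold I ∞ M]
    (g : SemiRiemannianMetric I M) (ε : ℝ) (hε : ε = 1 ∨ ε = -1)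
    {n : WithTop ℕ∞} (hn : n ≠ 0) (V : Π q : Cone M, TangentSpace (coneModel I) q)
    (hV : ContMDiff (coneModel I) (coneModel I).tangent n
      (fun q ↦ (⟨q, V q⟩ : TangentBundle (coneModel I) (Cone M))))
    (hpar : (coneMetric ε hε g).IsParallel V) :
    ∃ u : M → ℝ, ContMDiff I 𝓘(ℝ, ℝ) n u ∧
      (∀ q : Cone M, (coneMetric ε hε g).inner q (V q) (radialField I q) = u q.2) ∧
      (∀ q : Cone M, V q = (ε * u q.2) • radialField I q +
        (1 / (q.1 : ℝ)) • horizontalLift q (g.grad u q.2)) ∧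
      (∀ (p : M) (X : TangentSpace I p) (Y : Π x : M, TangentSpace I x), MDiffAt (T% Y) p →
        g.hessian u Y p X = -ε * u p * g.inner p X (Y p)) := by
  have hVdiff := hV.mdifferentiable hn
  let one : posReal := ⟨1, one_pos (α := ℝ)⟩
  let u : M → ℝ := fun p ↦ ε * dRadius I (one, p) (V (one, p))
  have hu (q : Cone M) : (coneMetric ε hε g).inner q (V q) (radialField I q) = u q.2 :=
    (coneMetric_inner_radialField_eq_of_isParallel hpar hVdiff q.1 one q.2).trans
      (coneMetric_inner_radialField ε hε g _)
  have hu_smooth : ContMDiff I 𝓘(ℝ, ℝ) n u :=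
    contMDiff_const.mul ((contMDiff_dRadius_apply hV).comp (contMDiff_const.prodMk contMDiff_id))
  exact ⟨u, hu_smooth, hu, eq_radialField_add_horizontalLift_grad_of_isParallel hpar hVdiff hu,
    fun _ X _ hY ↦ hessian_eq_neg_mul_inner_of_isParallel hpar hVdiff hu X hY⟩

theorem mainTheorem7
    {E : Type*} [NormedAddCommGroup E] [NormedSpace ℝ E] [FiniteDimensional ℝ E]
    {H : Type*} [TopologicalSpace H] {I : ModelWithCorners ℝ E H}
    {M : Type*} [TopologicalSpace M] [ChartedSpace H M] [IsManifold I ∞ M]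
    [BoundarylessManifold I M]
    (g : SemiRiemannianMetric I M) (ε : ℝ) (hε : ε = 1 ∨ ε = -1)
    (V : Π q : Cone M, TangentSpace (coneModel I) q)
    (hV : ContMDiff (coneModel I) (coneModel I).tangent ∞
      (fun q ↦ (⟨q, V q⟩ : TangentBundle (coneModel I) (Cone M))))
    (hpar : (coneMetric ε hε g).IsParallel V) :
    ∃ u : M → ℝ, ContMDiff I 𝓘(ℝ, ℝ) ∞ u ∧
      (∀ q : Cone M, (coneMetric ε hε g).inner q (V q) (radialField I q) = u q.2) ∧
      (∀ q : Cone M, V q = (ε * u q.2) • radialField I q +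
        (1 / (q.1 : ℝ)) • horizontalLift q (g.grad u q.2)) ∧
      (∀ (p : M) (X : TangentSpace I p) (Y : Π x : M, TangentSpace I x), MDiffAt (T% Y) p →
        g.hessian u Y p X = -ε * u p * g.inner p X (Y p)) :=
  mainTheorem7_general g ε hε (by simp) V hV hpar
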